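/- A $2$-colored graph is a triple $H=(V,E_r,E_b)$ with $V$ a finite set and $E_r,E_b\subseteq\binom V2$ (the red and the blue edges, not necessarily disjoint); it is proper if $E_r\neq\emptyset$ and $E_b\neq\emptyset$, and bipartite if it contains no odd cycle all of whose edges have the same color. $G$ contains $H$ if there is an injective map $V(H)\to V(G)$ sending red edges to red edges and blue edges to blue edges; $G$ is $H$-colorable if there is a (not necessarily injective) map $V(G)\to V(H)$ sending red edges to red edges and blue edges to blue edges. The Turán density of $H$ is $$\pi(H)=\lim_{n\to\infty}\max_{G}\frac{|E_r(G)|+|E_b(G)|}{\binom n2},$$ where the maximum is over all $2$-colored graphs $G$ on $n$ vertices that do not contain $H$. Let $T$ be the $2$-colored graph with vertex set $\{1,2,3,4\}$, red edges $12,13,34$ and blue edges $12,23,34$. Let $H_8$ be the $2$-colored graph with vertex set $\{1,\dots,8\}$, red edges $12,13,24,34,16,37,48,25,35,18,46,27$ and blue edges $56,57,68,78,26,15,47,38,35,18,46,27$. **Theorem.** Let $H$ be a proper $2$-colored graph. Then the limit defining $\pi(H)$ exists, and if $H$ is bipartite, then $\pi(H)\in\{1,\tfrac43,\tfrac32\}$.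 Moreover: 1. $H$ is degenerate, i.e. $\pi(H)=1$, if and only if $H$ is $T$-colorable. 2. If $\pi(H)=\tfrac43$, then $H$ is $H_8$-colorable but not $T$-colorable. 3. If $H$ is bipartite and $\pi(H)=\tfrac32$, then $H$ is not $H_8$-colorable. -/

import Mathlib

/-- A 2-edge-colored graph on the vertex set `V`: a set of red edges and a set of blue edges
(unordered pairs of distinct vertices), not necessarily disjoint. -/
@[ext]
structure TwoColoredGraph (V : Type*) where
  /-- The graph of red edges. -/
  red : SimpleGraph V
  /-- The graph of blue edges. -/
  blue : SimpleGraph V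

namespace TwoColoredGraph

/-- There is at least one edge of each color. -/
def Proper {V : Type*} (H : TwoColoredGraph V) : Prop :=
  H.red.edgeSet.Nonempty ∧ H.blue.edgeSet.Nonempty

/-- There is no odd cycle all of whose edges are red, and none all of whose edges are blue. -/
def Bipartite {V : Type*} (H : TwoColoredGraph V) : Prop :=
  (∀ (v : V) (c : H.red.Walk v v), c.IsCycle → ¬ Odd c.length) ∧
    ∀ (v : V) (c : H.blue.Walk v v), c.IsCycle → ¬ Odd c.length

/-- The map `f` sends red edges to red edges and blue edges to blue edges. -/
def IsHom {V W : Type*} (G : TwoColoredGraph V) (H : TwoColoredGraph W) (f : V → W) : Prop :=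
  (∀ u v, G.red.Adj u v → H.red.Adj (f u) (f v)) ∧
    ∀ u v, G.blue.Adj u v → H.blue.Adj (f u) (f v)

/-- `G.ColorableBy H`: the graph `G` is `H`-colorable, i.e. there is a homomorphism from `G`
to `H`. -/
def ColorableBy {V W : Type*} (G : TwoColoredGraph V) (H : TwoColoredGraph W) : Prop :=
  ∃ f : V → W, G.IsHom H f

/-- `G.Contains H`: the graph `G` has a (not necessarily induced) sub-graph that is a copy
of `H`. -/
def Contains {V W : Type*} (G : TwoColoredGraph V) (H : TwoColoredGraph W) : Prop :=
  ∃ f : W → V, Function.Injective f ∧ H.IsHom G f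

/-- The edge density `(|E_r(G)| + |E_b(G)|) / (n choose 2)` of a graph on `n` vertices. -/
noncomputable def density {n : ℕ} (G : TwoColoredGraph (Fin n)) : ℝ :=
  ((G.red.edgeSet.ncard : ℝ) + (G.blue.edgeSet.ncard : ℝ)) / (n.choose 2 : ℝ)

/-- The maximum edge density of an `H`-free 2-colored graph on `n` vertices. The set is finite,
and if `H` has an edge it is nonempty. -/
noncomputable def maxDensity {V : Type*} (H : TwoColoredGraph V) (n : ℕ) : ℝ :=
  sSup {d : ℝ | ∃ G : TwoColoredGraph (Fin n), ¬ G.Contains H ∧ G.density = d}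

/-- The Turán density of `H`, the limit of the maximum density of `H`-free graphs on `n`
vertices as `n` tends to infinity. -/
noncomputable def turanDensity {V : Type*} (H : TwoColoredGraph V) : ℝ :=
  Filter.limUnder Filter.atTop H.maxDensity

/-- A graph is degenerate if its Turán density is 1. -/
def Degenerate {V : Type*} (H : TwoColoredGraph V) : Prop :=
  H.turanDensity = 1

/-- The graph on `{1, 2, 3, 4}` with red edges 12, 13, 34 and blue edges 12, 23, 34;
the vertex `i` is represented by `i - 1 : Fin 4`. -/
def T : TwoColoredGraph (Fin 4) where
  red := SimpleGraph.fromEdgeSet {s(0, 1), s(0, 2), s(2, 3)}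
  blue := SimpleGraph.fromEdgeSet {s(0, 1), s(1, 2), s(2, 3)}

/-- The graph on `{1, ..., 8}` with red edges 12, 13, 24, 34, 16, 37, 48, 25, 35, 18, 46, 27 and
blue edges 56, 57, 68, 78, 26, 15, 47, 38, 35, 18, 46, 27;
the vertex `i` is represented by `i - 1 : Fin 8`. -/
def H₈ : TwoColoredGraph (Fin 8) where
  red := SimpleGraph.fromEdgeSet
    {s(0, 1), s(0, 2), s(1, 3), s(2, 3), s(0, 5), s(2, 6), s(3, 7), s(1, 4),
      s(2, 4), s(0, 7), s(3, 5), s(1, 6)}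
  blue := SimpleGraph.fromEdgeSet
    {s(4, 5), s(4, 6), s(5, 7), s(6, 7), s(1, 5), s(0, 4), s(3, 6), s(2, 7),
      s(2, 4), s(0, 7), s(3, 5), s(1, 6)}

end TwoColoredGraph

/-! Lower bounds. Split the vertices into two parts and fix the colors inside and between the parts;
a graph that does not map to such a pattern never embeds in it, so its Turán density is at least
that of the pattern. A proper graph fails to map to the all-red clique, which gives 1. Two patterns
have density 4/3, and a graph mapping to both maps to their product `T`. Three patterns have density
3/2, and a graph mapping to all three maps to their product `H₈`. Hence graphs that are not
`T`-colorable have density at least 4/3, and graphs that are not `H₈`-colorable at least 3/2.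

Upper bounds. Blowing up a forced graph keeps it forced (`ForcedAbove.of_colorableBy`), so it is
enough to force small graphs under a minimum degree condition (`forcedAbove_of_min_degree`). Degree
above 1, relative to the number of vertices and up to a constant, forces `T`; above 4/3,
`redBlueProduct` or `redBlueJoin`; above 3/2, `redBlueProduct`. Graphs that are `H₈`-colorable map
to both four-vertex graphs, and bipartite graphs map to `redBlueProduct`, so the bounds match. -/

namespace TwoColoredGraph

open Finset

open scoped Classical in
/-- The number of edges (0, 1 or 2) joining `x` and `y`. -/
noncomputable def weight {V : Type*} (G : TwoColoredGraph V) (x y : V) : ℕ :=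
  (if G.red.Adj x y then 1 else 0) + if G.blue.Adj x y then 1 else 0

section Weight

variable {V : Type*} (G : TwoColoredGraph V)

lemma weight_comm (x y : V) : G.weight x y = G.weight y x := by
  classical
  exact congrArg₂ (· + ·) (if_congr (G.red.adj_comm x y) rfl rfl)
    (if_congr (G.blue.adj_comm x y) rfl rfl)

@[simp]
lemma weight_self (x : V) : G.weight x x = 0 := by
  simp [weight]

lemma weight_le_two (x y : V) : G.weight x y ≤ 2 := by
  unfold weight
  split_ifs <;> simp

lemma two_le_weight {x y : V} : 2 ≤ G.weight x y ↔ G.red.Adj x y ∧ G.blue.Adj x y := by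
  unfold weight
  split_ifs <;> simp_all

lemma one_le_weight {x y : V} : 1 ≤ G.weight x y ↔ G.red.Adj x y ∨ G.blue.Adj x y := by
  unfold weight
  split_ifs <;> simp_all

end Weight

/-- The pullback of a 2-colored graph along a map. -/
def comap {V W : Type*} (f : V → W) (G : TwoColoredGraph W) : TwoColoredGraph V where
  red := G.red.comap f
  blue := G.blue.comap f

section Contains

variable {U V W : Type*}

@[simp]
lemma weight_comap (f : V → W) (G : TwoColoredGraph W) (x y : V) :
    (G.comap f).weight x y = G.weight (f x) (f y) :=
  rfl

lemma IsHom.comp {F : TwoColoredGraph U} {G : TwoColoredGraph V} {H : TwoColoredGraph W}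
    {g : V → W} {f : U → V} (hg : G.IsHom H g) (hf : F.IsHom G f) : F.IsHom H (g ∘ f) :=
  ⟨fun _ _ h => hg.1 _ _ (hf.1 _ _ h), fun _ _ h => hg.2 _ _ (hf.2 _ _ h)⟩

lemma isHom_comap (f : V → W) (G : TwoColoredGraph W) : (G.comap f).IsHom G f :=
  ⟨fun _ _ h => h, fun _ _ h => h⟩

lemma Contains.trans {F : TwoColoredGraph U} {G : TwoColoredGraph V} {H : TwoColoredGraph W}
    (h₁ : F.Contains G) (h₂ : G.Contains H) : F.Contains H := by
  obtain ⟨f, hf, hf'⟩ := h₁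
  obtain ⟨g, hg, hg'⟩ := h₂
  exact ⟨f ∘ g, hf.comp hg, hf'.comp hg'⟩

lemma contains_comap {f : V → W} (hf : f.Injective) (G : TwoColoredGraph W) :
    G.Contains (G.comap f) :=
  ⟨f, hf, isHom_comap f G⟩

end Contains

/-! ### Density as a normalized sum of weights over ordered pairs -/

section Density

lemma sum_adj_eq_two_mul_ncard {V : Type*} [Fintype V] (G : SimpleGraph V)
    [DecidableRel G.Adj] :
    ∑ x, ∑ y, (if G.Adj x y then 1 else 0 : ℕ) = 2 * G.edgeSet.ncard := by
  classical
  rw [← SimpleGraph.coe_edgeFinset, Set.ncard_coe_finset,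
    ← SimpleGraph.sum_degrees_eq_twice_card_edges]
  refine sum_congr rfl fun x _ => ?_
  rw [← SimpleGraph.card_neighborFinset_eq_degree, SimpleGraph.neighborFinset_eq_filter,
    card_filter]

lemma density_eq {n : ℕ} (G : TwoColoredGraph (Fin n)) :
    G.density = (∑ x, ∑ y, (G.weight x y : ℝ)) / (n * (n - 1)) := by
  classical
  have h : ∑ x, ∑ y, (G.weight x y : ℝ)
      = 2 * ((G.red.edgeSet.ncard : ℝ) + G.blue.edgeSet.ncard) := by
    have h1 : ∑ x, ∑ y, G.weight x y = 2 * (G.red.edgeSet.ncard + G.blue.edgeSet.ncard) := by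
      simp only [weight, sum_add_distrib]
      rw [sum_adj_eq_two_mul_ncard, sum_adj_eq_two_mul_ncard, mul_add]
    exact_mod_cast h1
  rw [density, h, Nat.cast_choose_two, div_div_eq_mul_div]
  ring

lemma sum_sum_ne_eq_card_mul {n : ℕ} (a : ℝ) :
    ∑ x : Fin n, ∑ y : Fin n, (if x = y then 0 else a) = n * (n - 1) * a := by
  have h (x y : Fin n) : (if x = y then 0 else a) = a - if x = y then a else 0 := by
    split_ifs <;> simp
  simp only [h, sum_sub_distrib, sum_const, card_univ, Fintype.card_fin, nsmul_eq_mul, sum_ite_eq,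
    mem_univ, if_true]
  ring

lemma density_nonneg {n : ℕ} (G : TwoColoredGraph (Fin n)) : 0 ≤ G.density := by
  unfold density
  positivity

lemma density_le_two {n : ℕ} (G : TwoColoredGraph (Fin n)) : G.density ≤ 2 := by
  rw [density_eq]
  have h0 : (0 : ℝ) ≤ n * (n - 1) := by
    rcases n.eq_zero_or_pos with rfl | h
    · simp
    · have : (1 : ℝ) ≤ n := by exact_mod_cast h
      nlinarith
  refine div_le_of_le_mul₀ h0 (by norm_num) ?_
  rw [mul_comm, ← sum_sum_ne_eq_card_mul]
  refine sum_le_sum fun x _ => sum_le_sum fun y _ => ?_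
  split_ifs with h
  · simp [h]
  · exact_mod_cast G.weight_le_two x y

end Density

/-! ### Averaging over random induced subgraphs -/

section Averaging

/-- The sum of a function of embeddings over the orbit of one embedding under all permutations
does not depend on the embedding. -/
lemma sum_perm_comp_eq {V α : Type*} [Finite V] [Fintype α] [DecidableEq α]
    (F : (V → α) → ℝ) {e e' : V → α} (he : e.Injective) (he' : e'.Injective) :
    ∑ σ : Equiv.Perm α, F (σ ∘ e) = ∑ σ : Equiv.Perm α, F (σ ∘ e') := by
  obtain ⟨τ, hτ⟩ := Equiv.Perm.exists_extending_pair e' e he' he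
  refine Fintype.sum_equiv (Equiv.mulRight τ) _ _ fun σ => ?_
  congr 1
  ext x
  simp [hτ]

/-- Double counting of pairs of an embedding and a permutation: a uniformly random permutation turns
a fixed embedding into a uniformly random one. -/
lemma card_mul_sum_perm {V α : Type*} [Fintype V] [Fintype α] [DecidableEq α] [DecidableEq V]
    (F : (V → α) → ℝ) (e : V ↪ α) :
    (Fintype.card (V ↪ α) : ℝ) * ∑ σ : Equiv.Perm α, F (σ ∘ e)
      = (Fintype.card (Equiv.Perm α) : ℝ) * ∑ e' : V ↪ α, F e' := by
  have h1 : ∑ e' : V ↪ α, ∑ σ : Equiv.Perm α, F (σ ∘ e')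
      = (Fintype.card (V ↪ α) : ℝ) * ∑ σ : Equiv.Perm α, F (σ ∘ e) := by
    rw [sum_congr rfl fun e' _ => sum_perm_comp_eq F e'.injective e.injective, sum_const,
      card_univ, nsmul_eq_mul]
  rw [← h1, sum_comm]
  have h2 (σ : Equiv.Perm α) : ∑ e' : V ↪ α, F (σ ∘ e') = ∑ e' : V ↪ α, F e' :=
    Fintype.sum_equiv (Equiv.embeddingCongr (Equiv.refl V) σ) _ _ fun e' => by
      congr 1
  simp [h2]

/-- The density of a graph is the average of the densities of its induced subgraphs with a
given number of vertices. -/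
lemma sum_perm_density {m n : ℕ} (hm : 2 ≤ m) (hmn : m ≤ n) (G : TwoColoredGraph (Fin n)) :
    ∑ σ : Equiv.Perm (Fin n), (G.comap (σ ∘ Fin.castLE hmn)).density
      = (Fintype.card (Equiv.Perm (Fin n)) : ℝ) * G.density := by
  have hn : 2 ≤ n := hm.trans hmn
  let a : Fin n := ⟨0, by omega⟩
  let b : Fin n := ⟨1, by omega⟩
  have hab : a ≠ b := by simp [a, b]
  let S : ℝ := ∑ σ : Equiv.Perm (Fin n), (G.weight (σ a) (σ b) : ℝ)
  -- Permutations act transitively on ordered pairs of distinct vertices, so the sum is the same for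
  -- all of them.
  have key (x y : Fin n) :
      ∑ σ : Equiv.Perm (Fin n), (G.weight (σ x) (σ y) : ℝ) = if x = y then 0 else S := by
    split_ifs with h
    · simp [h]
    · refine sum_perm_comp_eq (fun f : Bool → Fin n => (G.weight (f true) (f false) : ℝ))
        (e := fun t => cond t x y) (e' := fun t => cond t a b) ?_ ?_
      · rintro (_ | _) (_ | _) <;> simp [h, Ne.symm h]
      · rintro (_ | _) (_ | _) <;> simp [hab, hab.symm]
  have hG : (n * (n - 1) : ℝ) * S
      = (Fintype.card (Equiv.Perm (Fin n)) : ℝ) * ∑ x, ∑ y, (G.weight x y : ℝ) := by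
    rw [← sum_sum_ne_eq_card_mul]
    simp only [← key]
    rw [sum_congr rfl fun x _ => sum_comm, sum_comm, ← nsmul_eq_mul, ← card_univ, ← sum_const]
    refine sum_congr rfl fun σ _ => ?_
    rw [← Equiv.sum_comp σ fun x => ∑ y, (G.weight x y : ℝ)]
    exact sum_congr rfl fun x _ => Equiv.sum_comp σ fun y => (G.weight (σ x) y : ℝ)
  have hm1 : ∑ σ : Equiv.Perm (Fin n), ∑ x : Fin m, ∑ y : Fin m,
      ((G.comap (σ ∘ Fin.castLE hmn)).weight x y : ℝ) = (m * (m - 1) : ℝ) * S := by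
    rw [sum_comm, ← sum_sum_ne_eq_card_mul]
    refine sum_congr rfl fun x _ => ?_
    rw [sum_comm]
    refine sum_congr rfl fun y _ => ?_
    simp [key]
  have hm0 : (m * (m - 1) : ℝ) ≠ 0 := by
    have : (2 : ℝ) ≤ m := by exact_mod_cast hm
    nlinarith
  have hn0 : (n * (n - 1) : ℝ) ≠ 0 := by
    have : (2 : ℝ) ≤ n := by exact_mod_cast hn
    nlinarith
  simp only [density_eq]
  rw [← sum_div, hm1, mul_div_assoc', ← hG, mul_div_cancel_left₀ _ hm0,
    mul_div_cancel_left₀ _ hn0]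

end Averaging

/-! ### Existence of the limit -/

section Limit

variable {V : Type*} (H : TwoColoredGraph V)

lemma bddAbove_densities (n : ℕ) :
    BddAbove {d : ℝ | ∃ G : TwoColoredGraph (Fin n), ¬ G.Contains H ∧ G.density = d} := by
  refine ⟨2, ?_⟩
  rintro _ ⟨G, -, rfl⟩
  exact G.density_le_two

lemma density_le_maxDensity {n : ℕ} {G : TwoColoredGraph (Fin n)} (h : ¬ G.Contains H) :
    G.density ≤ H.maxDensity n :=
  le_csSup (H.bddAbove_densities n) ⟨G, h, rfl⟩

lemma maxDensity_nonneg (n : ℕ) : 0 ≤ H.maxDensity n := by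
  refine Real.sSup_nonneg ?_
  rintro _ ⟨G, -, rfl⟩
  exact G.density_nonneg

/-- The sign condition on `c` covers the empty set, whose `sSup` is 0. -/
lemma maxDensity_le {n : ℕ} {c : ℝ} (hc : 0 ≤ c)
    (h : ∀ G : TwoColoredGraph (Fin n), ¬ G.Contains H → G.density ≤ c) :
    H.maxDensity n ≤ c := by
  refine Real.sSup_le ?_ hc
  rintro _ ⟨G, hG, rfl⟩
  exact h G hG

lemma maxDensity_anti {m n : ℕ} (hm : 2 ≤ m) (hmn : m ≤ n) :
    H.maxDensity n ≤ H.maxDensity m := by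
  refine H.maxDensity_le (H.maxDensity_nonneg m) fun G hG => ?_
  have h1 : (Fintype.card (Equiv.Perm (Fin n)) : ℝ) * G.density
      ≤ (Fintype.card (Equiv.Perm (Fin n)) : ℝ) * H.maxDensity m := by
    rw [← sum_perm_density hm hmn, ← nsmul_eq_mul, ← card_univ, ← sum_const]
    refine sum_le_sum fun σ _ => H.density_le_maxDensity fun hc => hG ?_
    exact (contains_comap (σ.injective.comp (Fin.castLE_injective hmn)) G).trans hc
  exact le_of_mul_le_mul_left h1 (by exact_mod_cast Fintype.card_pos)

/-- The limit defining the Turán density exists. -/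
theorem tendsto_maxDensity :
    Filter.Tendsto H.maxDensity Filter.atTop (nhds H.turanDensity) := by
  -- The shift by 2 avoids `n < 2`, where division by zero makes every density 0 and monotonicity
  -- can fail.
  have h : Filter.Tendsto (fun n => H.maxDensity (n + 2)) Filter.atTop
      (nhds (⨅ n, H.maxDensity (n + 2))) :=
    tendsto_atTop_ciInf (fun m n h => H.maxDensity_anti (by omega) (by omega))
      ⟨0, by rintro _ ⟨n, rfl⟩; exact H.maxDensity_nonneg _⟩
  exact tendsto_nhds_limUnder ⟨_, (Filter.tendsto_add_atTop_iff_nat 2).1 h⟩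

end Limit

/-! ### Lower bounds from two-part patterns -/

section LowerBound

/-- The graph whose vertices are split into two parts by `p`, where the colors of the pair `x, y`
are prescribed by `R` and `B` in terms of the parts of `x` and `y`. -/
def twoPart {α : Type*} (R B : Bool → Bool → Bool) (p : α → Bool) : TwoColoredGraph α where
  red := SimpleGraph.fromRel fun x y => R (p x) (p y)
  blue := SimpleGraph.fromRel fun x y => B (p x) (p y)

lemma le_weight_twoPart {α : Type*} (R B : Bool → Bool → Bool) (p : α → Bool) {x y : α}
    (hxy : x ≠ y) :
    (R (p x) (p y)).toNat + (B (p x) (p y)).toNat ≤ (twoPart R B p).weight x y := by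
  unfold weight twoPart
  simp only [SimpleGraph.fromRel_adj, ne_eq, hxy, not_false_eq_true, true_and]
  refine Nat.add_le_add ?_ ?_
  · cases R (p x) (p y) <;> simp
  · cases B (p x) (p y) <;> simp

lemma sum_part {k l : ℕ} (f : Bool → ℝ) :
    ∑ x : Fin (k + l), f (decide (x.val < k)) = k * f true + l * f false := by
  rw [Fin.sum_univ_add]
  simp

/-- The pattern also prescribes colors on the diagonal, where the graph has no edges; each of the `k
+ l` diagonal entries costs at most 2. -/
lemma le_sum_weight_twoPart (R B : Bool → Bool → Bool) (k l : ℕ) :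
    (k : ℝ) ^ 2 * ((R true true).toNat + (B true true).toNat)
      + k * l * ((R true false).toNat + (B true false).toNat)
      + k * l * ((R false true).toNat + (B false true).toNat)
      + (l : ℝ) ^ 2 * ((R false false).toNat + (B false false).toNat) - 2 * (k + l)
    ≤ ∑ x : Fin (k + l), ∑ y : Fin (k + l),
        ((twoPart R B fun x : Fin (k + l) => decide (x.val < k)).weight x y : ℝ) := by
  let M (s t : Bool) : ℝ := (R s t).toNat + (B s t).toNat
  let p (x : Fin (k + l)) : Bool := decide (x.val < k)
  have h1 : ∑ x, ∑ y, M (p x) (p y)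
      = (k : ℝ) * (k * M true true + l * M true false)
        + l * (k * M false true + l * M false false) := by
    rw [← sum_part fun s => (k * M s true + l * M s false : ℝ)]
    exact sum_congr rfl fun x _ => sum_part (M (p x))
  have h2 : ∑ x : Fin (k + l), ∑ y : Fin (k + l), (if x = y then (2 : ℝ) else 0)
      = 2 * (k + l) := by
    simp [mul_comm]
  have h3 : ∑ x, ∑ y, M (p x) (p y) ≤ ∑ x, ∑ y, ((twoPart R B p).weight x y : ℝ)
      + ∑ x : Fin (k + l), ∑ y : Fin (k + l), (if x = y then (2 : ℝ) else 0) := by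
    simp only [← sum_add_distrib]
    refine sum_le_sum fun x _ => sum_le_sum fun y _ => ?_
    split_ifs with h
    · have h1 : ((R (p x) (p y)).toNat : ℝ) ≤ 1 := by exact_mod_cast Bool.toNat_le _
      have h2 : ((B (p x) (p y)).toNat : ℝ) ≤ 1 := by exact_mod_cast Bool.toNat_le _
      have h3 : (0 : ℝ) ≤ (twoPart R B p).weight x y := Nat.cast_nonneg _
      simp only [M]
      linarith
    · rw [add_zero]
      simp only [M]
      exact_mod_cast le_weight_twoPart R B p h
  rw [h1, h2] at h3
  simp only [M] at h3
  linarith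

/-- A graph that cannot be mapped to a given two-part pattern has Turán density at least the
density of the pattern with parts of relative sizes `a / (a + b)` and `b / (a + b)`. -/
lemma le_turanDensity_of_twoPart {V : Type*} (H : TwoColoredGraph V) (R B : Bool → Bool → Bool)
    (hR : ∀ s t, R s t = R t s) (hB : ∀ s t, B s t = B t s) (a b : ℕ) (c : ℝ) (hab : 0 < a + b)
    (hc : c * (a + b) ^ 2 ≤ (a : ℝ) ^ 2 * ((R true true).toNat + (B true true).toNat)
      + a * b * ((R true false).toNat + (B true false).toNat)
      + a * b * ((R false true).toNat + (B false true).toNat)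
      + (b : ℝ) ^ 2 * ((R false false).toNat + (B false false).toNat))
    (hH : ¬ ∃ f : V → Bool, (∀ u v, H.red.Adj u v → R (f u) (f v) = true) ∧
      ∀ u v, H.blue.Adj u v → B (f u) (f v) = true) :
    c ≤ H.turanDensity := by
  -- The limit exists, so the subsequence on which the part sizes are exactly `a * j` and `b * j` is
  -- enough.
  have hsub : Filter.Tendsto (fun j : ℕ => a * j + b * j) Filter.atTop Filter.atTop := by
    refine Filter.tendsto_atTop_mono (fun j => ?_) Filter.tendsto_id
    rw [← add_mul]
    exact Nat.le_mul_of_pos_left _ hab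
  have hlim : Filter.Tendsto (fun j : ℕ => c - 2 / ((a * j + b * j : ℕ) : ℝ)) Filter.atTop
      (nhds (c - 0)) :=
    tendsto_const_nhds.sub ((tendsto_const_div_atTop_nhds_zero_nat 2).comp hsub)
  rw [sub_zero] at hlim
  refine le_of_tendsto_of_tendsto hlim (H.tendsto_maxDensity.comp hsub) ?_
  filter_upwards [hsub.eventually_ge_atTop 2] with j hj
  let G := twoPart R B fun x : Fin (a * j + b * j) => decide (x.val < a * j)
  have hG : ¬ G.Contains H := by
    rintro ⟨f, -, h1, h2⟩
    refine hH ⟨fun v => decide ((f v).val < a * j), fun u v h => ?_, fun u v h => ?_⟩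
    · exact (h1 u v h).2.elim id fun h => (hR _ _).trans h
    · exact (h2 u v h).2.elim id fun h => (hB _ _).trans h
  refine le_trans ?_ (H.density_le_maxDensity hG)
  rw [density_eq]
  have hW := le_sum_weight_twoPart R B (a * j) (b * j)
  change _ ≤ ∑ x, ∑ y, (G.weight x y : ℝ) at hW
  have hW0 : 0 ≤ ∑ x, ∑ y, (G.weight x y : ℝ) :=
    sum_nonneg fun x _ => sum_nonneg fun y _ => Nat.cast_nonneg _
  generalize ∑ x, ∑ y, (G.weight x y : ℝ) = W at hW hW0
  have hn : (2 : ℝ) ≤ ((a * j + b * j : ℕ) : ℝ) := by exact_mod_cast hj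
  have hcn : c * ((a * j + b * j : ℕ) : ℝ) ^ 2 - 2 * ((a * j + b * j : ℕ) : ℝ) ≤ W := by
    refine le_trans ?_ hW
    have := mul_le_mul_of_nonneg_right hc (sq_nonneg (j : ℝ))
    push_cast
    linarith
  generalize ((a * j + b * j : ℕ) : ℝ) = n at hn hcn
  have hpos : 0 < n * (n - 1) := by nlinarith
  calc c - 2 / n = (c * n ^ 2 - 2 * n) / n ^ 2 := by field_simp
    _ ≤ W / n ^ 2 := by gcongr
    _ ≤ W / (n * (n - 1)) := by
      refine div_le_div_of_nonneg_left hW0 hpos ?_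
      nlinarith

variable {V : Type*} (H : TwoColoredGraph V)

lemma one_le_turanDensity (hH : H.Proper) : 1 ≤ H.turanDensity := by
  refine H.le_turanDensity_of_twoPart (fun _ _ => true) (fun _ _ => false) (by simp) (by simp)
    1 0 1 (by norm_num) (by norm_num) ?_
  rintro ⟨f, -, h⟩
  obtain ⟨e, he⟩ := hH.2
  induction e with
  | _ x y => simpa using h x y he

/-- Cliques of different colors joined completely in both colors. -/
lemma three_halves_le_turanDensity_of_not_split
    (hH : ¬ ∃ f : V → Bool, (∀ u v, H.red.Adj u v → f u = true ∨ f v = true) ∧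
      ∀ u v, H.blue.Adj u v → f u = false ∨ f v = false) :
    3 / 2 ≤ H.turanDensity := by
  refine H.le_turanDensity_of_twoPart (fun s t => s || t) (fun s t => !s || !t)
    (by decide) (by decide) 1 1 _ (by norm_num) (by norm_num) fun ⟨f, h1, h2⟩ => hH ⟨f, ?_, ?_⟩
  · simpa using h1
  · simpa using h2

/-- The pattern is a blue clique together with a balanced complete bipartite red graph. -/
lemma three_halves_le_turanDensity_of_not_red
    (hH : ¬ ∃ f : V → Bool, ∀ u v, H.red.Adj u v → f u ≠ f v) :
    3 / 2 ≤ H.turanDensity := by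
  refine H.le_turanDensity_of_twoPart (fun s t => s != t) (fun _ _ => true)
    (by decide) (by decide) 1 1 _ (by norm_num) (by norm_num) fun ⟨f, h1, _⟩ => hH ⟨f, ?_⟩
  simpa using h1

lemma three_halves_le_turanDensity_of_not_blue
    (hH : ¬ ∃ f : V → Bool, ∀ u v, H.blue.Adj u v → f u ≠ f v) :
    3 / 2 ≤ H.turanDensity := by
  refine H.le_turanDensity_of_twoPart (fun _ _ => true) (fun s t => s != t)
    (by decide) (by decide) 1 1 _ (by norm_num) (by norm_num) fun ⟨f, _, h1⟩ => hH ⟨f, ?_⟩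
  simpa using h1

/-- A red clique is joined in both colors to an independent set. With relative clique size `x` the
density is `4x - 3x²`, which is largest at `x = 2/3`; hence the sizes 2 and 1. -/
lemma four_thirds_le_turanDensity_of_not_red_cover
    (hH : ¬ ∃ f : V → Bool, (∀ u v, H.red.Adj u v → f u = true ∨ f v = true) ∧
      ∀ u v, H.blue.Adj u v → f u ≠ f v) :
    4 / 3 ≤ H.turanDensity := by
  refine H.le_turanDensity_of_twoPart (fun s t => s || t) (fun s t => s != t)
    (by decide) (by decide) 2 1 _ (by norm_num) (by norm_num) fun ⟨f, h1, h2⟩ => hH ⟨f, ?_, ?_⟩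
  · simpa using h1
  · simpa using h2

lemma four_thirds_le_turanDensity_of_not_blue_cover
    (hH : ¬ ∃ f : V → Bool, (∀ u v, H.red.Adj u v → f u ≠ f v) ∧
      ∀ u v, H.blue.Adj u v → f u = true ∨ f v = true) :
    4 / 3 ≤ H.turanDensity := by
  refine H.le_turanDensity_of_twoPart (fun s t => s != t) (fun s t => s || t)
    (by decide) (by decide) 2 1 _ (by norm_num) (by norm_num) fun ⟨f, h1, h2⟩ => hH ⟨f, ?_, ?_⟩
  · simpa using h1
  · simpa using h2

instance : DecidableRel T.red.Adj := fun a b => by unfold T; infer_instance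

instance : DecidableRel T.blue.Adj := fun a b => by unfold T; infer_instance

instance : DecidableRel H₈.red.Adj := fun a b => by unfold H₈; infer_instance

instance : DecidableRel H₈.blue.Adj := fun a b => by unfold H₈; infer_instance

/-- `T` is the product of the two patterns of density `4 / 3`. -/
lemma colorableBy_T_of_covers {f g : V → Bool}
    (hf1 : ∀ u v, H.red.Adj u v → f u = true ∨ f v = true)
    (hf2 : ∀ u v, H.blue.Adj u v → f u ≠ f v)
    (hg1 : ∀ u v, H.red.Adj u v → g u ≠ g v)
    (hg2 : ∀ u v, H.blue.Adj u v → g u = true ∨ g v = true) : H.ColorableBy T := by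
  -- The four vertices of `T` are the pairs of parts in the two patterns.
  let q : Bool → Bool → Fin 4 := fun s t => cond s (cond t 2 0) (cond t 1 3)
  have hred : ∀ s t s' t', (s = true ∨ s' = true) → t ≠ t' → T.red.Adj (q s t) (q s' t') := by
    decide
  have hblue : ∀ s t s' t', s ≠ s' → (t = true ∨ t' = true) → T.blue.Adj (q s t) (q s' t') := by
    decide
  exact ⟨fun v => q (f v) (g v), fun u v h => hred _ _ _ _ (hf1 u v h) (hg1 u v h),
    fun u v h => hblue _ _ _ _ (hf2 u v h) (hg2 u v h)⟩

/-- `H₈` is the product of the three patterns of density `3 / 2`. -/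
lemma colorableBy_H₈_of_split {f r b : V → Bool}
    (hf1 : ∀ u v, H.red.Adj u v → f u = true ∨ f v = true)
    (hf2 : ∀ u v, H.blue.Adj u v → f u = false ∨ f v = false)
    (hr : ∀ u v, H.red.Adj u v → r u ≠ r v)
    (hb : ∀ u v, H.blue.Adj u v → b u ≠ b v) : H.ColorableBy H₈ := by
  -- The vertices 0 to 3 lie in the red half of the split pattern and 4 to 7 in the blue half; `r`
  -- and `b` are the sides of the red and the blue bipartition.
  let q : Bool → Bool → Bool → Fin 8 := fun s r b =>
    cond s (cond r (cond b 2 1) (cond b 0 3)) (cond r (cond b 5 7) (cond b 6 4))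
  have hred : ∀ s r b s' r' b', (s = true ∨ s' = true) → r ≠ r' →
      H₈.red.Adj (q s r b) (q s' r' b') := by
    decide
  have hblue : ∀ s r b s' r' b', (s = false ∨ s' = false) → b ≠ b' →
      H₈.blue.Adj (q s r b) (q s' r' b') := by
    decide
  exact ⟨fun v => q (f v) (r v) (b v), fun u v h => hred _ _ _ _ _ _ (hf1 u v h) (hr u v h),
    fun u v h => hblue _ _ _ _ _ _ (hf2 u v h) (hb u v h)⟩

lemma four_thirds_le_turanDensity_of_not_colorableBy_T (hH : ¬ H.ColorableBy T) :
    4 / 3 ≤ H.turanDensity := by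
  by_contra hlt
  obtain ⟨f, hf1, hf2⟩ := not_not.1 (mt H.four_thirds_le_turanDensity_of_not_red_cover hlt)
  obtain ⟨g, hg1, hg2⟩ := not_not.1 (mt H.four_thirds_le_turanDensity_of_not_blue_cover hlt)
  exact hH (H.colorableBy_T_of_covers hf1 hf2 hg1 hg2)

lemma three_halves_le_turanDensity_of_not_colorableBy_H₈ (hH : ¬ H.ColorableBy H₈) :
    3 / 2 ≤ H.turanDensity := by
  by_contra hlt
  obtain ⟨f, hf1, hf2⟩ := not_not.1 (mt H.three_halves_le_turanDensity_of_not_split hlt)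
  obtain ⟨r, hr⟩ := not_not.1 (mt H.three_halves_le_turanDensity_of_not_red hlt)
  obtain ⟨b, hb⟩ := not_not.1 (mt H.three_halves_le_turanDensity_of_not_blue hlt)
  exact hH (H.colorableBy_H₈_of_split hf1 hf2 hr hb)

end LowerBound

/-! ### Supersaturation and blow-ups -/

/-- Large graphs of density larger than `c` by a constant contain `K₁` or `K₂`. -/
def ForcedAbove {V W : Type*} (c : ℝ) (K₁ : TwoColoredGraph V) (K₂ : TwoColoredGraph W) : Prop :=
  ∀ ε > 0, ∃ N, ∀ n ≥ N, ∀ G : TwoColoredGraph (Fin n),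
    ¬ G.Contains K₁ → ¬ G.Contains K₂ → G.density ≤ c + ε

section ForcedAbove

variable {U V W : Type*} {c : ℝ}

lemma ForcedAbove.symm {K₁ : TwoColoredGraph V} {K₂ : TwoColoredGraph W}
    (h : ForcedAbove c K₁ K₂) : ForcedAbove c K₂ K₁ := fun ε hε =>
  let ⟨N, hN⟩ := h ε hε
  ⟨N, fun n hn G h₁ h₂ => hN n hn G h₂ h₁⟩

lemma ForcedAbove.of_contains {K₁ : TwoColoredGraph V} {K₂ : TwoColoredGraph W}
    {K : TwoColoredGraph U} (h : ForcedAbove c K₁ K₂) (hK : K₁.Contains K) :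
    ForcedAbove c K K₂ := fun ε hε =>
  let ⟨N, hN⟩ := h ε hε
  ⟨N, fun n hn G h₁ h₂ => hN n hn G (fun hG => h₁ (hG.trans hK)) h₂⟩

lemma ForcedAbove.turanDensity_le {H : TwoColoredGraph V} (hc : 0 ≤ c)
    (h : ForcedAbove c H H) : H.turanDensity ≤ c := by
  refine le_of_forall_pos_le_add fun ε hε => ?_
  obtain ⟨N, hN⟩ := h ε hε
  refine le_of_tendsto H.tendsto_maxDensity ?_
  filter_upwards [Filter.eventually_ge_atTop N] with n hn
  exact H.maxDensity_le (by positivity) fun G hG => hN n hn G hG hG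

/-- If `u` and `v` are twins in `K`, then two copies of `K - v` that differ only in the image of
`u` form a copy of `K`. -/
lemma contains_of_twins {K : TwoColoredGraph V} {u v : V} (huv : u ≠ v)
    (hred : ∀ x, K.red.Adj v x ↔ K.red.Adj u x) (hblue : ∀ x, K.blue.Adj v x ↔ K.blue.Adj u x)
    {G : TwoColoredGraph W} {e e' : {x // x ≠ v} ↪ W}
    (he : (K.comap Subtype.val).IsHom G e) (he' : (K.comap Subtype.val).IsHom G e')
    (heq : ∀ x : {x // x ≠ v}, x.1 ≠ u → e x = e' x) (hne : e ⟨u, huv⟩ ≠ e' ⟨u, huv⟩) :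
    G.Contains K := by
  classical
  let f : V → W := fun x => if h : x = v then e' ⟨u, huv⟩ else e ⟨x, h⟩
  have hfv : f v = e' ⟨u, huv⟩ := by simp [f]
  have hf (x : V) (h : x ≠ v) : f x = e ⟨x, h⟩ := by simp [f, h]
  have hfne (x : V) (h : x ≠ v) : f v ≠ f x := by
    rw [hfv, hf x h]
    by_cases hx : x = u
    · subst hx
      exact hne.symm
    · rw [heq ⟨x, h⟩ hx]
      intro hcon
      exact hx (congrArg Subtype.val (e'.injective hcon)).symm
  have adj (K₀ : SimpleGraph V) (G₀ : SimpleGraph W) (htw : ∀ x, K₀.Adj v x ↔ K₀.Adj u x)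
      (h : ∀ x y : {x // x ≠ v}, K₀.Adj x y → G₀.Adj (e x) (e y))
      (h' : ∀ x y : {x // x ≠ v}, K₀.Adj x y → G₀.Adj (e' x) (e' y)) (x y : V)
      (hxy : K₀.Adj x y) : G₀.Adj (f x) (f y) := by
    have hv (z : V) (hz : K₀.Adj v z) : G₀.Adj (f v) (f z) := by
      have hzv : z ≠ v := hz.ne'
      have huz := (htw z).1 hz
      rw [hfv, hf z hzv, heq ⟨z, hzv⟩ huz.ne']
      exact h' ⟨u, huv⟩ ⟨z, hzv⟩ huz
    by_cases hx : x = v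
    · subst hx
      exact hv y hxy
    by_cases hy : y = v
    · subst hy
      exact (hv x hxy.symm).symm
    rw [hf x hx, hf y hy]
    exact h ⟨x, hx⟩ ⟨y, hy⟩ hxy
  refine ⟨f, fun x y hxy => ?_, adj _ _ hred he.1 he'.1, adj _ _ hblue he.2 he'.2⟩
  by_cases hx : x = v
  · by_cases hy : y = v
    · rw [hx, hy]
    · subst hx
      exact absurd hxy (hfne y hy)
  · by_cases hy : y = v
    · subst hy
      exact absurd hxy.symm (hfne x hx)
    · rw [hf x hx, hf y hy] at hxy
      exact congrArg Subtype.val (e.injective hxy)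

open scoped Classical in
/-- A graph without a copy of `K` has few copies of the graph obtained by removing one of two
twins. -/
lemma card_copies_mul_le [Fintype V] {K : TwoColoredGraph V} {u v : V} (huv : u ≠ v)
    (hred : ∀ x, K.red.Adj v x ↔ K.red.Adj u x) (hblue : ∀ x, K.blue.Adj v x ↔ K.blue.Adj u x)
    {n : ℕ} {G : TwoColoredGraph (Fin n)} (hG : ¬ G.Contains K) :
    (n - Fintype.card V) *
        #{e : {x // x ≠ v} ↪ Fin n | (K.comap Subtype.val).IsHom G e}
      ≤ Fintype.card ({x // x ≠ v} ↪ Fin n) := by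
  let u' : {x // x ≠ v} := ⟨u, huv⟩
  let r (e : {x // x ≠ v} ↪ Fin n) : {x : {x // x ≠ v} // x ≠ u'} ↪ Fin n :=
    (Function.Embedding.subtype _).trans e
  -- Without a copy of `K`, a copy of `K - v` is determined by its values off `u`: two that differ
  -- only at `u` would form `K`.
  have h1 : #{e : {x // x ≠ v} ↪ Fin n | (K.comap Subtype.val).IsHom G e}
      ≤ Fintype.card ({x : {x // x ≠ v} // x ≠ u'} ↪ Fin n) := by
    rw [← card_univ]
    refine card_le_card_of_injOn r (fun _ _ => mem_coe.2 (mem_univ _)) fun e he e' he' hr => ?_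
    have heq (x : {x // x ≠ v}) (hx : x ≠ u') : e x = e' x :=
      DFunLike.congr_fun hr (⟨x, hx⟩ : {x : {x // x ≠ v} // x ≠ u'})
    have hu : e u' = e' u' := by
      by_contra hne
      refine hG (contains_of_twins huv hred hblue (by simpa using he) (by simpa using he')
        (fun x hx => heq x fun h => hx ?_) hne)
      rw [h]
    ext x
    by_cases hx : x = u'
    · rw [hx, hu]
    · rw [heq x hx]
  have h2 : Fintype.card {x : {x // x ≠ v} // x ≠ u'} + 1 = Fintype.card {x // x ≠ v} := by
    rw [Fintype.card_subtype_compl, Fintype.card_subtype_eq]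
    exact Nat.sub_add_cancel (Fintype.card_pos_iff.2 ⟨u'⟩)
  have h3 : Fintype.card {x // x ≠ v} ≤ Fintype.card V := Fintype.card_subtype_le _
  rw [Fintype.card_embedding_eq] at h1 ⊢
  rw [← h2, Nat.descFactorial_succ, Fintype.card_fin] at *
  exact Nat.mul_le_mul (by omega) h1

open scoped Classical in
/-- The number of permutations for which a given induced subgraph contains `K₀`. -/
lemma card_perm_contains_le {V₀ : Type*} [Fintype V₀] (K₀ : TwoColoredGraph V₀) {m n : ℕ}
    (hmn : m ≤ n) (G : TwoColoredGraph (Fin n)) :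
    (Fintype.card (V₀ ↪ Fin n) : ℝ) *
        #{σ : Equiv.Perm (Fin n) | (G.comap (σ ∘ Fin.castLE hmn)).Contains K₀}
      ≤ Fintype.card (V₀ ↪ Fin m) * (Fintype.card (Equiv.Perm (Fin n)) *
        #{e : V₀ ↪ Fin n | K₀.IsHom G e}) := by
  let F (e : V₀ → Fin n) : ℝ := if K₀.IsHom G e then 1 else 0
  -- Union bound over the placements `ψ` of `K₀` in the `m` sampled vertices.
  have h1 : (#{σ : Equiv.Perm (Fin n) | (G.comap (σ ∘ Fin.castLE hmn)).Contains K₀} : ℝ)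
      ≤ ∑ ψ : V₀ ↪ Fin m, ∑ σ : Equiv.Perm (Fin n), F (σ ∘ (ψ.trans (Fin.castLEEmb hmn))) := by
    rw [sum_comm, card_filter]
    push_cast
    refine sum_le_sum fun σ _ => ?_
    split_ifs with h
    · obtain ⟨f, hf, hf'⟩ := h
      refine le_trans ?_ (single_le_sum
        (f := fun ψ : V₀ ↪ Fin m => F (σ ∘ (ψ.trans (Fin.castLEEmb hmn))))
        (fun ψ _ => ?_) (mem_univ (⟨f, hf⟩ : V₀ ↪ Fin m)))
      · have : K₀.IsHom G (σ ∘ (Function.Embedding.trans ⟨f, hf⟩ (Fin.castLEEmb hmn))) :=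
          (isHom_comap (σ ∘ Fin.castLE hmn) G).comp hf'
        simp only [F]
        rw [if_pos this]
      · simp only [F]
        split_ifs <;> simp
    · refine sum_nonneg fun ψ _ => ?_
      simp only [F]
      split_ifs <;> simp
  have h2 : ∑ e : V₀ ↪ Fin n, F e = #{e : V₀ ↪ Fin n | K₀.IsHom G e} := by
    simp [F]
  calc _ ≤ (Fintype.card (V₀ ↪ Fin n) : ℝ) * ∑ ψ : V₀ ↪ Fin m, ∑ σ : Equiv.Perm (Fin n),
        F (σ ∘ (ψ.trans (Fin.castLEEmb hmn))) := by gcongr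
    _ = ∑ ψ : V₀ ↪ Fin m, (Fintype.card (Equiv.Perm (Fin n)) : ℝ) * ∑ e : V₀ ↪ Fin n, F e := by
      rw [mul_sum]
      exact sum_congr rfl fun ψ _ => card_mul_sum_perm F _
    _ = _ := by
      rw [h2, sum_const, card_univ, nsmul_eq_mul]

/-- Adding a twin of a vertex preserves being forced. -/
lemma ForcedAbove.of_twins [Finite V] (hc : 0 ≤ c) {K : TwoColoredGraph V} {u v : V} (huv : u ≠ v)
    (hred : ∀ x, K.red.Adj v x ↔ K.red.Adj u x) (hblue : ∀ x, K.blue.Adj v x ↔ K.blue.Adj u x)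
    {K₂ : TwoColoredGraph W}
    (h : ForcedAbove c (K.comap (Subtype.val : {x // x ≠ v} → V)) K₂) :
    ForcedAbove c K K₂ := by
  classical
  have := Fintype.ofFinite V
  intro ε hε
  obtain ⟨N, hN⟩ := h (ε / 2) (by positivity)
  let m := max N 2
  let M : ℝ := Fintype.card ({x // x ≠ v} ↪ Fin m)
  obtain ⟨N', hN'⟩ := exists_nat_ge (4 * M / ε)
  refine ⟨max m (N' + Fintype.card V + 1), fun n hn G hG hG₂ => ?_⟩
  have hmn : m ≤ n := (le_max_left _ _).trans hn
  have hn' : N' + Fintype.card V + 1 ≤ n := (le_max_right _ _).trans hn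
  let A := #{σ : Equiv.Perm (Fin n) |
    (G.comap (σ ∘ Fin.castLE hmn)).Contains (K.comap (Subtype.val : {x // x ≠ v} → V))}
  let P : ℝ := Fintype.card (Equiv.Perm (Fin n))
  have hP : 0 < P := Nat.cast_pos.2 Fintype.card_pos
  -- A bad sample has density at most 2, so a proportion `ε / 4` of bad samples uses up the
  -- remaining `ε / 2`.
  have hA : 4 * (A : ℝ) ≤ ε * P := by
    have h1 := card_perm_contains_le (K.comap (Subtype.val : {x // x ≠ v} → V)) hmn G
    have h2 := card_copies_mul_le huv hred hblue hG
    have h3 : N' * #{e : {x // x ≠ v} ↪ Fin n | (K.comap Subtype.val).IsHom G e}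
        ≤ Fintype.card ({x // x ≠ v} ↪ Fin n) :=
      le_trans (Nat.mul_le_mul_right _ (by omega)) h2
    have h3' : (N' : ℝ) * #{e : {x // x ≠ v} ↪ Fin n | (K.comap Subtype.val).IsHom G e}
        ≤ Fintype.card ({x // x ≠ v} ↪ Fin n) := by exact_mod_cast h3
    have hE : (0 : ℝ) < Fintype.card ({x // x ≠ v} ↪ Fin n) := by
      have : Fintype.card {x // x ≠ v} ≤ n :=
        (Fintype.card_subtype_le _).trans (by omega)
      rw [Fintype.card_embedding_eq, Fintype.card_fin]
      exact_mod_cast Nat.descFactorial_pos.2 this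
    refine le_of_mul_le_mul_left ?_ hE
    calc (Fintype.card ({x // x ≠ v} ↪ Fin n) : ℝ) * (4 * A)
        = 4 * (Fintype.card ({x // x ≠ v} ↪ Fin n) * A) := by ring
      _ ≤ 4 * (M * (P * #{e : {x // x ≠ v} ↪ Fin n | (K.comap Subtype.val).IsHom G e})) := by
        gcongr
      _ = 4 * M * (#{e : {x // x ≠ v} ↪ Fin n | (K.comap Subtype.val).IsHom G e} * P) := by ring
      _ ≤ N' * ε * (#{e : {x // x ≠ v} ↪ Fin n | (K.comap Subtype.val).IsHom G e} * P) := by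
        exact mul_le_mul_of_nonneg_right ((div_le_iff₀ hε).1 hN') (by positivity)
      _ = N' * #{e : {x // x ≠ v} ↪ Fin n | (K.comap Subtype.val).IsHom G e} * (ε * P) := by ring
      _ ≤ Fintype.card ({x // x ≠ v} ↪ Fin n) * (ε * P) := by gcongr
  have hsum : P * G.density ≤ P * (c + ε / 2) + 2 * A := by
    have h1 : P * (c + ε / 2) + 2 * A = ∑ σ : Equiv.Perm (Fin n), ((c + ε / 2) +
        if (G.comap (σ ∘ Fin.castLE hmn)).Contains (K.comap (Subtype.val : {x // x ≠ v} → V))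
          then 2 else 0) := by
      rw [sum_add_distrib, ← sum_filter, sum_const, sum_const, card_univ, nsmul_eq_mul,
        nsmul_eq_mul, mul_comm (A : ℝ)]
    rw [h1, ← sum_perm_density (le_max_right N 2) hmn]
    refine sum_le_sum fun σ _ => ?_
    split_ifs with hσ
    · have := density_le_two (G.comap (σ ∘ Fin.castLE hmn))
      linarith
    · rw [add_zero]
      refine hN m (le_max_left _ _) _ hσ fun hcon => hG₂ ?_
      exact (contains_comap (σ.injective.comp (Fin.castLE_injective hmn)) G).trans hcon
  refine le_of_mul_le_mul_left ?_ hP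
  linarith

/-- Blowing up vertices preserves being forced. -/
lemma ForcedAbove.comap [Finite V] (hc : 0 ≤ c) {K : TwoColoredGraph U} {K₂ : TwoColoredGraph W}
    (h : ForcedAbove c K K₂) (f : V → U) : ForcedAbove c (K.comap f) K₂ := by
  induction hk : Nat.card V generalizing V with
  | zero =>
    have : IsEmpty V := Finite.card_eq_zero_iff.1 hk
    exact h.of_contains (contains_comap (fun x => isEmptyElim x) K)
  | succ k ih =>
    by_cases hf : f.Injective
    · exact h.of_contains (contains_comap hf K)
    -- Two vertices with the same image are twins in the pullback; one of them is removed.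
    · obtain ⟨u, v, huv, hne⟩ := Function.not_injective_iff.1 hf
      refine ForcedAbove.of_twins hc hne (fun x => ?_) (fun x => ?_)
        (ih (f ∘ (Subtype.val : {x // x ≠ v} → V)) ?_)
      · simp [TwoColoredGraph.comap, huv]
      · simp [TwoColoredGraph.comap, huv]
      · classical
        have := Fintype.ofFinite V
        rw [Nat.card_eq_fintype_card] at hk ⊢
        rw [Fintype.card_subtype_compl, Fintype.card_subtype_eq, hk]
        rfl

lemma ForcedAbove.of_colorableBy [Finite V] (hc : 0 ≤ c) {K : TwoColoredGraph U}
    {K₂ : TwoColoredGraph W} (h : ForcedAbove c K K₂) {H : TwoColoredGraph V}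
    (hH : H.ColorableBy K) : ForcedAbove c H K₂ := by
  obtain ⟨f, hf⟩ := hH
  exact (h.comap hc f).of_contains ⟨id, Function.injective_id, hf⟩

end ForcedAbove

/-! ### Small graphs forced by minimum degree -/

section LocalDensity

/-- Delete a low-degree vertex and induct. Ordered pairs count its degree twice, and `2 * (c * k +
C)` is exactly the increment of the bound from `k - 1` to `k`. -/
lemma sum_weight_le_of_exists_low_degree {V : Type*} [DecidableEq V] (G : TwoColoredGraph V)
    {c C : ℝ} (hlow : ∀ S : Finset V, S.Nonempty →
      ∃ x ∈ S, ∑ y ∈ S, (G.weight x y : ℝ) ≤ c * #S + C) (S : Finset V) :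
    ∑ x ∈ S, ∑ y ∈ S, (G.weight x y : ℝ) ≤ c * (#S : ℝ) ^ 2 + (2 * C + c) * #S := by
  induction hk : #S generalizing S with
  | zero => simp [card_eq_zero.1 hk]
  | succ k ih =>
    obtain ⟨x, hx, hdeg⟩ := hlow S (card_pos.1 (by omega))
    have hcard : #(S.erase x) = k := by rw [card_erase_of_mem hx, hk]; rfl
    have hIH := ih _ hcard
    have hxx : ∑ y ∈ S, (G.weight x y : ℝ) = ∑ y ∈ S.erase x, (G.weight x y : ℝ) := by
      rw [← add_sum_erase S _ hx]
      simp
    have hsum : ∑ z ∈ S, ∑ y ∈ S, (G.weight z y : ℝ)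
        = 2 * ∑ y ∈ S, (G.weight x y : ℝ)
          + ∑ z ∈ S.erase x, ∑ y ∈ S.erase x, (G.weight z y : ℝ) := by
      rw [← add_sum_erase S _ hx,
        sum_congr rfl fun z _ => (add_sum_erase S (fun y => (G.weight z y : ℝ)) hx).symm,
        sum_add_distrib, hxx]
      simp only [G.weight_comm _ x]
      ring
    rw [hsum]
    rw [hk] at hdeg
    push_cast at hdeg hIH ⊢
    nlinarith

lemma forcedAbove_of_min_degree {V W : Type*} {c C : ℝ}
    {K₁ : TwoColoredGraph V} {K₂ : TwoColoredGraph W}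
    (h : ∀ (n : ℕ) (G : TwoColoredGraph (Fin n)) (S : Finset (Fin n)), S.Nonempty →
      (∀ x ∈ S, c * #S + C < ∑ y ∈ S, (G.weight x y : ℝ)) → G.Contains K₁ ∨ G.Contains K₂) :
    ForcedAbove c K₁ K₂ := by
  intro ε hε
  -- This is the condition on `n` for `c * n ^ 2 + (2 * C + c) * n ≤ (c + ε) * n * (n - 1)`.
  obtain ⟨N, hN⟩ := exists_nat_ge ((2 * C + 2 * c + ε) / ε)
  refine ⟨max N 2, fun n hn G h₁ h₂ => ?_⟩
  have hsum := G.sum_weight_le_of_exists_low_degree (c := c) (C := C) (fun S hS => ?_) univ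
  · rw [card_univ, Fintype.card_fin] at hsum
    have hn2 : (2 : ℝ) ≤ n := by exact_mod_cast (le_max_right _ _).trans hn
    have hnN : (N : ℝ) ≤ n := by exact_mod_cast (le_max_left _ _).trans hn
    have hn0 : (0 : ℝ) < n * (n - 1) := by nlinarith
    have hεn := (div_le_iff₀ hε).1 (hN.trans hnN)
    rw [density_eq, div_le_iff₀ hn0]
    nlinarith
  · by_contra! hcon
    exact (h n G S hS hcon).elim h₁ h₂

/-- The product of the red edge and the blue edge. -/
def redBlueProduct : TwoColoredGraph (Bool × Bool) where
  red := SimpleGraph.fromRel fun x y => x.1 ≠ y.1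
  blue := SimpleGraph.fromRel fun x y => x.2 ≠ y.2

/-- A red pair and a blue pair, joined completely in both colors. -/
def redBlueJoin : TwoColoredGraph (Bool × Bool) where
  red := SimpleGraph.fromRel fun x y => x.1 = true ∨ y.1 = true
  blue := SimpleGraph.fromRel fun x y => x.1 = false ∨ y.1 = false

variable {V : Type*} {G : TwoColoredGraph V}

/-- Any two vertices of `K` are adjacent in some color and `G` has no loops, so a homomorphism is
automatically injective. -/
lemma contains_of_adj {K : TwoColoredGraph (Bool × Bool)} {f : Bool × Bool → V}
    (h : ∀ x y, x ≠ y → K.red.Adj x y ∨ K.blue.Adj x y) (hf : K.IsHom G f) : G.Contains K := by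
  refine ⟨f, fun x y hxy => ?_, hf⟩
  by_contra hne
  rcases h x y hne with h | h
  · exact (hf.1 _ _ h).ne hxy
  · exact (hf.2 _ _ h).ne hxy

lemma contains_redBlueProduct {a b c d : V} (hab : G.red.Adj a b) (hab' : G.blue.Adj a b)
    (hcd : G.red.Adj c d) (hcd' : G.blue.Adj c d) (had : G.red.Adj a d) (hbc : G.red.Adj b c)
    (hac : G.blue.Adj a c) (hbd : G.blue.Adj b d) : G.Contains redBlueProduct := by
  refine contains_of_adj (f := fun x => cond x.1 (cond x.2 b d) (cond x.2 c a)) ?_ ⟨?_, ?_⟩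
  · rintro ⟨_ | _, _ | _⟩ ⟨_ | _, _ | _⟩ <;> simp [redBlueProduct]
  · rintro ⟨_ | _, _ | _⟩ ⟨_ | _, _ | _⟩ <;>
      simp [redBlueProduct, hab, hab.symm, hcd, hcd.symm, had, had.symm, hbc, hbc.symm]
  · rintro ⟨_ | _, _ | _⟩ ⟨_ | _, _ | _⟩ <;>
      simp [redBlueProduct, hab', hab'.symm, hcd', hcd'.symm, hac, hac.symm, hbd, hbd.symm]

lemma contains_redBlueJoin {a b c d : V} (hab : G.red.Adj a b) (hcd : G.blue.Adj c d)
    (hac : 2 ≤ G.weight a c) (had : 2 ≤ G.weight a d) (hbc : 2 ≤ G.weight b c)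
    (hbd : 2 ≤ G.weight b d) : G.Contains redBlueJoin := by
  rw [two_le_weight] at *
  refine contains_of_adj (f := fun x => cond x.1 (cond x.2 a b) (cond x.2 c d)) ?_ ⟨?_, ?_⟩
  · rintro ⟨_ | _, _ | _⟩ ⟨_ | _, _ | _⟩ <;> simp [redBlueJoin]
  · rintro ⟨_ | _, _ | _⟩ ⟨_ | _, _ | _⟩ <;>
      simp [redBlueJoin, hab, hab.symm, hac.1, hac.1.symm, hbc.1, hbc.1.symm, had.1, had.1.symm,
        hbd.1, hbd.1.symm]
  · rintro ⟨_ | _, _ | _⟩ ⟨_ | _, _ | _⟩ <;>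
      simp [redBlueJoin, hcd, hcd.symm, hac.2, hac.2.symm, hbc.2, hbc.2.symm, had.2, had.2.symm,
        hbd.2, hbd.2.symm]

/-- Four vertices joined completely in both colors, except that one edge may be missing. -/
lemma contains_redBlueProduct_of_single {a b c d : V} (hab : 1 ≤ G.weight a b)
    (hac : 2 ≤ G.weight a c) (had : 2 ≤ G.weight a d) (hbc : 2 ≤ G.weight b c)
    (hbd : 2 ≤ G.weight b d) (hcd : 2 ≤ G.weight c d) : G.Contains redBlueProduct := by
  rw [two_le_weight] at *
  -- `redBlueProduct` is a double perfect matching, a red one and a blue one; `ab` is placed in the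
  -- matching of its own color.
  rcases G.one_le_weight.1 hab with h | h
  · exact contains_redBlueProduct (a := a) (b := c) (c := d) (d := b) hac.1 hac.2
      hbd.1.symm hbd.2.symm h hcd.1 had.2 hbc.2.symm
  · exact contains_redBlueProduct (a := a) (b := c) (c := b) (d := d) hac.1 hac.2
      hbd.1 hbd.2 had.1 hbc.1.symm h hcd.2

lemma exists_two_le_weight {S : Finset V} {c : ℝ} (hc : 1 ≤ c) {x : V}
    (hx : c * #S < ∑ y ∈ S, (G.weight x y : ℝ)) : ∃ y ∈ S, 2 ≤ G.weight x y := by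
  have h : ∑ y ∈ S, (1 : ℝ) < ∑ y ∈ S, (G.weight x y : ℝ) := by
    rw [sum_const, nsmul_eq_mul, mul_one]
    nlinarith [(Nat.cast_nonneg #S : (0 : ℝ) ≤ #S)]
  obtain ⟨y, hy, hlt⟩ := exists_lt_of_sum_lt h
  exact ⟨y, hy, by exact_mod_cast hlt⟩

lemma exists_le_weight_pair {S : Finset V} {c : ℝ} {k : ℕ} (hc : k ≤ 2 * c) {x y : V}
    (hx : c * #S < ∑ z ∈ S, (G.weight x z : ℝ)) (hy : c * #S < ∑ z ∈ S, (G.weight y z : ℝ)) :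
    ∃ z ∈ S, k + 1 ≤ G.weight x z + G.weight y z := by
  have h : ∑ z ∈ S, (k : ℝ) < ∑ z ∈ S, ((G.weight x z : ℝ) + G.weight y z) := by
    rw [sum_const, nsmul_eq_mul, sum_add_distrib]
    nlinarith [(Nat.cast_nonneg #S : (0 : ℝ) ≤ #S)]
  obtain ⟨z, hz, hlt⟩ := exists_lt_of_sum_lt h
  exact ⟨z, hz, by exact_mod_cast hlt⟩

/-- The average total weight from a vertex of `S` to the triple exceeds 4. A total of 5 out of 6
means that at most one of the three joins is not double, and that one is single. -/
lemma exists_five_le_weight_triple {S : Finset V} {c : ℝ} (hc : 4 / 3 ≤ c) {x y z : V}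
    (hx : c * #S < ∑ w ∈ S, (G.weight x w : ℝ)) (hy : c * #S < ∑ w ∈ S, (G.weight y w : ℝ))
    (hz : c * #S < ∑ w ∈ S, (G.weight z w : ℝ)) :
    ∃ w ∈ S, 5 ≤ G.weight x w + G.weight y w + G.weight z w := by
  have h : ∑ w ∈ S, (4 : ℝ)
      < ∑ w ∈ S, ((G.weight x w : ℝ) + G.weight y w + G.weight z w) := by
    rw [sum_const, nsmul_eq_mul, sum_add_distrib, sum_add_distrib]
    nlinarith [(Nat.cast_nonneg #S : (0 : ℝ) ≤ #S)]
  obtain ⟨w, hw, hlt⟩ := exists_lt_of_sum_lt h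
  exact ⟨w, hw, by exact_mod_cast hlt⟩

lemma contains_redBlueProduct_of_double_triangle {S : Finset V} {c : ℝ} (hc : 4 / 3 ≤ c)
    (hS : ∀ x ∈ S, c * #S < ∑ y ∈ S, (G.weight x y : ℝ)) {x y z : V} (hx : x ∈ S) (hy : y ∈ S)
    (hz : z ∈ S) (hxy : 2 ≤ G.weight x y) (hxz : 2 ≤ G.weight x z) (hyz : 2 ≤ G.weight y z) :
    G.Contains redBlueProduct := by
  obtain ⟨w, -, hw⟩ := exists_five_le_weight_triple hc (hS x hx) (hS y hy) (hS z hz)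
  have h1 := G.weight_le_two x w
  have h2 := G.weight_le_two y w
  have h3 := G.weight_le_two z w
  rw [G.weight_comm y w, G.weight_comm x w, G.weight_comm z w] at *
  by_cases hxw : 2 ≤ G.weight w x
  · by_cases hyw : 2 ≤ G.weight w y
    · exact contains_redBlueProduct_of_single (a := w) (b := z) (c := x) (d := y) (by omega) hxw
        hyw (by rwa [weight_comm]) (by rwa [weight_comm]) hxy
    · exact contains_redBlueProduct_of_single (a := w) (b := y) (c := x) (d := z) (by omega) hxw
        (by omega) (by rwa [weight_comm]) hyz hxz
  · exact contains_redBlueProduct_of_single (a := w) (b := x) (c := y) (d := z) (by omega)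
      (by omega) (by omega) hxy hxz hyz

theorem forcedAbove_three_halves : ForcedAbove (3 / 2) redBlueProduct redBlueProduct := by
  refine forcedAbove_of_min_degree (C := 0) fun n G S hS hdeg => Or.inl ?_
  simp only [add_zero] at hdeg
  obtain ⟨x, hx⟩ := hS
  obtain ⟨y, hy, hxy⟩ := exists_two_le_weight (by norm_num) (hdeg x hx)
  obtain ⟨z, hz, hxyz⟩ := exists_le_weight_pair (k := 3) (by norm_num) (hdeg x hx) (hdeg y hy)
  have h1 := G.weight_le_two x z
  have h2 := G.weight_le_two y z
  exact contains_redBlueProduct_of_double_triangle (by norm_num) hdeg hx hy hz hxy (by omega)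
    (by omega)

theorem forcedAbove_four_thirds : ForcedAbove (4 / 3) redBlueProduct redBlueJoin := by
  refine forcedAbove_of_min_degree (C := 0) fun n G S hS hdeg => ?_
  simp only [add_zero] at hdeg
  obtain ⟨x, hx⟩ := hS
  obtain ⟨y, hy, hxy⟩ := exists_two_le_weight (by norm_num) (hdeg x hx)
  obtain ⟨z, hz, hxyz⟩ := exists_le_weight_pair (k := 2) (by norm_num) (hdeg x hx) (hdeg y hy)
  -- a triangle with two double edges meeting in `p`
  obtain ⟨p, q, r, hp, hq, hr, hpq, hpr, hqr⟩ : ∃ p q r, p ∈ S ∧ q ∈ S ∧ r ∈ S ∧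
      2 ≤ G.weight p q ∧ 2 ≤ G.weight p r ∧ 1 ≤ G.weight q r := by
    have h1 := G.weight_le_two x z
    have h2 := G.weight_le_two y z
    by_cases hxz : 2 ≤ G.weight x z
    · exact ⟨x, y, z, hx, hy, hz, hxy, hxz, by omega⟩
    · exact ⟨y, x, z, hy, hx, hz, by rwa [weight_comm], by omega, by omega⟩
  obtain ⟨w, hw, hw5⟩ := exists_five_le_weight_triple (by norm_num) (hdeg p hp) (hdeg q hq)
    (hdeg r hr)
  have h1 := G.weight_le_two p w
  have h2 := G.weight_le_two q w
  have h3 := G.weight_le_two r w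
  by_cases hpw : 2 ≤ G.weight p w
  · left
    by_cases hqw : 2 ≤ G.weight q w
    · exact contains_redBlueProduct_of_double_triangle (by norm_num) hdeg hp hq hw hpq hpw hqw
    · exact contains_redBlueProduct_of_double_triangle (by norm_num) hdeg hp hr hw hpr hpw
        (by omega)
  -- Now `p, q, w, r` is a 4-cycle of double edges with single-colored diagonals `qr` and `pw`
  -- available. Equal diagonal colors give `redBlueProduct`, different ones `redBlueJoin`.
  · have hqw : 2 ≤ G.weight q w := by omega
    have hrw : 2 ≤ G.weight r w := by omega
    rcases G.one_le_weight.1 hqr with hqr | hqr <;>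
      rcases G.one_le_weight.1 (show 1 ≤ G.weight p w by omega) with hpw | hpw
    · rw [two_le_weight] at *
      exact Or.inl (contains_redBlueProduct (a := p) (b := q) (c := r) (d := w) hpq.1 hpq.2
        hrw.1 hrw.2 hpw hqr hpr.2 hqw.2)
    · exact Or.inr (contains_redBlueJoin (a := q) (b := r) (c := p) (d := w) hqr hpw
        (by rwa [weight_comm]) hqw (by rwa [weight_comm]) hrw)
    · exact Or.inr (contains_redBlueJoin (a := p) (b := w) (c := q) (d := r) hpw hqr hpq hpr
        (by rwa [weight_comm]) (by rwa [weight_comm]))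
    · rw [two_le_weight] at *
      exact Or.inl (contains_redBlueProduct (a := p) (b := q) (c := w) (d := r) hpq.1 hpq.2
        hrw.1.symm hrw.2.symm hpr.1 hqw.1 hpw hqr)

lemma contains_T {a b c d : V} (hab : 2 ≤ G.weight a b) (hac : G.red.Adj a c)
    (hbc : G.blue.Adj b c) (hcd : 2 ≤ G.weight c d) (hda : d ≠ a) (hdb : d ≠ b) :
    G.Contains T := by
  rw [two_le_weight] at hab hcd
  have h1 := hab.1.ne
  have h2 := hac.ne
  have h3 := hbc.ne
  have h4 := hcd.1.ne
  refine ⟨![a, b, c, d], fun x y => ?_, fun x y => ?_, fun x y => ?_⟩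
  · fin_cases x <;> fin_cases y <;>
      simp [h1, h2, h3, h4, hda, hdb, h1.symm, h2.symm, h3.symm, h4.symm, hda.symm, hdb.symm]
  · fin_cases x <;> fin_cases y <;>
      simp [T, hab.1, hab.1.symm, hac, hac.symm, hcd.1, hcd.1.symm]
  · fin_cases x <;> fin_cases y <;>
      simp [T, hab.2, hab.2.symm, hbc, hbc.symm, hcd.2, hcd.2.symm]

/-- A double edge `xy` and a vertex `z` sending total weight at least 3 to it give a triangle in
which one of `xz`, `yz` can be taken red and the other blue. A double edge from `z` completes `T`.
-/
theorem forcedAbove_one : ForcedAbove 1 T T := by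
  refine forcedAbove_of_min_degree (C := 2) fun n G S hS hdeg =>
    Or.inl ?_
  have hdeg' : ∀ x ∈ S, (1 : ℝ) * #S < ∑ y ∈ S, (G.weight x y : ℝ) := fun x hx =>
    lt_trans (by linarith) (hdeg x hx)
  obtain ⟨x, hx⟩ := hS
  obtain ⟨y, hy, hxy⟩ := exists_two_le_weight le_rfl (hdeg' x hx)
  obtain ⟨z, hz, hxyz⟩ := exists_le_weight_pair (k := 2) (by norm_num) (hdeg' x hx) (hdeg' y hy)
  -- If only `x` and `y` could be joined doubly to `z`, the degree of `z` would be at most `#S + 2`;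
  -- hence `C = 2`.
  obtain ⟨d, -, hzd, hdx, hdy⟩ : ∃ d ∈ S, 2 ≤ G.weight z d ∧ d ≠ x ∧ d ≠ y := by
    by_contra! hcon
    have hle : ∑ d ∈ S, (G.weight z d : ℝ)
        ≤ ∑ d ∈ S, ((1 + if d = x then 1 else 0) + if d = y then 1 else 0 : ℝ) := by
      refine sum_le_sum fun d hd => ?_
      have hw : G.weight z d ≤ (1 + if d = x then 1 else 0) + if d = y then 1 else 0 := by
        have h2 := G.weight_le_two z d
        by_cases hdx : d = x
        · simp only [hdx, if_true] at h2 ⊢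
          omega
        · by_cases h : 2 ≤ G.weight z d
          · simp only [hcon d hd h hdx, if_true] at h2 ⊢
            omega
          · omega
      exact_mod_cast hw
    have := hdeg z hz
    simp only [sum_add_distrib, sum_const, sum_ite_eq', hx, hy, if_true, nsmul_eq_mul] at hle
    linarith
  have h1 := G.weight_le_two x z
  have h2 := G.weight_le_two y z
  by_cases hxz : 2 ≤ G.weight x z
  · rw [two_le_weight] at hxz
    rcases G.one_le_weight.1 (show 1 ≤ G.weight y z by omega) with h | h
    · exact contains_T (a := y) (b := x) (by rwa [weight_comm]) h hxz.2 hzd hdy hdx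
    · exact contains_T hxy hxz.1 h hzd hdx hdy
  · have hyz := G.two_le_weight.1 (show 2 ≤ G.weight y z by omega)
    rcases G.one_le_weight.1 (show 1 ≤ G.weight x z by omega) with h | h
    · exact contains_T hxy h hyz.2 hzd hdx hdy
    · exact contains_T (a := y) (b := x) (by rwa [weight_comm]) hyz.1 h hzd hdy hdx

end LocalDensity

end TwoColoredGraph

/-! ### Two-colorings of simple graphs without odd cycles -/

namespace SimpleGraph

variable {V : Type*} {G : SimpleGraph V}

/-- If there are no odd cycles, then shortcutting a walk to a path preserves its parity. -/
lemma Walk.even_length_bypass_iff [DecidableEq V]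
    (hG : ∀ (v : V) (c : G.Walk v v), c.IsCycle → ¬ Odd c.length) {u v : V} (p : G.Walk u v) :
    Even p.bypass.length ↔ Even p.length := by
  induction p with
  | nil => simp [Walk.bypass]
  | @cons u w v hadj q ih =>
    rw [Walk.bypass, Walk.length_cons, Nat.even_add_one, ← ih]
    split_ifs with hs
    · have hlen := congrArg Walk.length (q.bypass.take_spec hs)
      rw [Walk.length_append] at hlen
      have hpath : (q.bypass.takeUntil u hs).IsPath := q.bypass_isPath.takeUntil hs
      -- The discarded closed walk at `u` either goes back and forth along one edge or is a cycle;
      -- both have even length.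
      have hodd : Odd (q.bypass.takeUntil u hs).length := by
        by_cases he : s(u, w) ∈ (q.bypass.takeUntil u hs).edges
        · rw [hpath.length_eq_one_of_mem_edges (Sym2.eq_swap ▸ he)]
          exact odd_one
        · have := hG u (Walk.cons hadj (q.bypass.takeUntil u hs))
            ((Walk.cons_isCycle_iff _ hadj).2 ⟨hpath, he⟩)
          rw [Walk.length_cons] at this
          grind
      rw [← hlen]
      grind
    · rw [Walk.length_cons, Nat.even_add_one]

/-- A closed walk shortcuts to the trivial path, so its length is even. -/
theorem exists_bool_coloring_of_no_odd_cycle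
    (hG : ∀ (v : V) (c : G.Walk v v), c.IsCycle → ¬ Odd c.length) :
    ∃ f : V → Bool, ∀ u v, G.Adj u v → f u ≠ f v := by
  classical
  have h2 : G.Colorable 2 := two_colorable_iff_forall_loop_even.2 fun u w => by
    rw [← w.even_length_bypass_iff hG, (Walk.isPath_iff_nil.1 w.bypass_isPath).eq_nil]
    simp
  have C : G.Coloring Bool := h2.toColoring (by simp)
  exact ⟨C, fun u v h => C.valid h⟩

end SimpleGraph

namespace TwoColoredGraph

/-! ### Homomorphisms to the forced graphs and upper bounds -/

section UpperBound

variable {V : Type*}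

lemma Bipartite.colorableBy_redBlueProduct {H : TwoColoredGraph V} (hH : H.Bipartite) :
    H.ColorableBy redBlueProduct := by
  obtain ⟨r, hr⟩ := SimpleGraph.exists_bool_coloring_of_no_odd_cycle hH.1
  obtain ⟨b, hb⟩ := SimpleGraph.exists_bool_coloring_of_no_odd_cycle hH.2
  refine ⟨fun v => (r v, b v), fun u v h => ?_, fun u v h => ?_⟩
  · simp [redBlueProduct, hr u v h]
  · simp [redBlueProduct, hb u v h]

lemma H₈_colorableBy_redBlueProduct : H₈.ColorableBy redBlueProduct := by
  let r : Fin 8 → Bool := ![false, true, true, false, false, true, false, true]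
  let b : Fin 8 → Bool := ![true, false, true, false, false, true, true, false]
  have hr : ∀ u v, H₈.red.Adj u v → r u ≠ r v := by decide
  have hb : ∀ u v, H₈.blue.Adj u v → b u ≠ b v := by decide
  refine ⟨fun v => (r v, b v), fun u v h => ?_, fun u v h => ?_⟩
  · simp [redBlueProduct, hr u v h]
  · simp [redBlueProduct, hb u v h]

lemma H₈_colorableBy_redBlueJoin : H₈.ColorableBy redBlueJoin := by
  let s : Fin 8 → Bool := ![true, true, true, true, false, false, false, false]
  -- `t` is the red side on the red half and the blue side on the blue half, so it separates the
  -- ends of every edge inside a half.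
  let t : Fin 8 → Bool := ![false, true, true, false, false, true, true, false]
  have hred : ∀ u v, H₈.red.Adj u v → (s u, t u) ≠ (s v, t v) ∧ (s u = true ∨ s v = true) := by
    decide
  have hblue : ∀ u v, H₈.blue.Adj u v →
      (s u, t u) ≠ (s v, t v) ∧ (s u = false ∨ s v = false) := by
    decide
  exact ⟨fun v => (s v, t v), fun u v h => ⟨(hred u v h).1, Or.inl (hred u v h).2⟩,
    fun u v h => ⟨(hblue u v h).1, Or.inl (hblue u v h).2⟩⟩

lemma ColorableBy.trans {U W : Type*} {F : TwoColoredGraph U} {G : TwoColoredGraph V}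
    {H : TwoColoredGraph W} (h₁ : F.ColorableBy G) (h₂ : G.ColorableBy H) : F.ColorableBy H := by
  obtain ⟨f, hf⟩ := h₁
  obtain ⟨g, hg⟩ := h₂
  exact ⟨g ∘ f, hg.comp hf⟩

variable [Finite V] {H : TwoColoredGraph V}

lemma turanDensity_le_one (hH : H.ColorableBy T) : H.turanDensity ≤ 1 :=
  ((forcedAbove_one.of_colorableBy zero_le_one hH).symm.of_colorableBy zero_le_one
    hH).turanDensity_le zero_le_one

/-- Either of two graphs may be the one that is forced, so `H` has to map to both; they are replaced
by `H` one at a time. -/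
lemma turanDensity_le_four_thirds (hH : H.ColorableBy H₈) : H.turanDensity ≤ 4 / 3 := by
  have hc : (0 : ℝ) ≤ 4 / 3 := by norm_num
  have h1 := forcedAbove_four_thirds.of_colorableBy hc (hH.trans H₈_colorableBy_redBlueProduct)
  have h2 := h1.symm.of_colorableBy hc (hH.trans H₈_colorableBy_redBlueJoin)
  exact h2.turanDensity_le hc

lemma turanDensity_le_three_halves (hH : H.Bipartite) : H.turanDensity ≤ 3 / 2 := by
  have hc : (0 : ℝ) ≤ 3 / 2 := by norm_num
  have h1 := forcedAbove_three_halves.of_colorableBy hc hH.colorableBy_redBlueProduct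
  have h2 := h1.symm.of_colorableBy hc hH.colorableBy_redBlueProduct
  exact h2.turanDensity_le hc

end UpperBound

end TwoColoredGraph

/-! ### Combining the bounds -/

theorem theorem1p2 {V : Type*} [Finite V] (H : TwoColoredGraph V) (hH : H.Proper) :
    Filter.Tendsto H.maxDensity Filter.atTop (nhds H.turanDensity) ∧
    (H.Bipartite →
      H.turanDensity = 1 ∨ H.turanDensity = 4 / 3 ∨ H.turanDensity = 3 / 2) ∧
    (H.Degenerate ↔ H.ColorableBy TwoColoredGraph.T) ∧
    (H.turanDensity = 4 / 3 →
      H.ColorableBy TwoColoredGraph.H₈ ∧ ¬ H.ColorableBy TwoColoredGraph.T) ∧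
    (H.Bipartite → H.turanDensity = 3 / 2 → ¬ H.ColorableBy TwoColoredGraph.H₈) := by
  have hT (h : H.ColorableBy TwoColoredGraph.T) : H.turanDensity = 1 :=
    le_antisymm (TwoColoredGraph.turanDensity_le_one h) (H.one_le_turanDensity hH)
  have hT' := H.four_thirds_le_turanDensity_of_not_colorableBy_T
  have h8' := H.three_halves_le_turanDensity_of_not_colorableBy_H₈
  refine ⟨H.tendsto_maxDensity, fun hB => ?_, ⟨fun h => ?_, hT⟩, fun h => ⟨?_, fun hc => ?_⟩,
    fun _ h hc => ?_⟩
  · by_cases h1 : H.ColorableBy TwoColoredGraph.T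
    · exact Or.inl (hT h1)
    by_cases h2 : H.ColorableBy TwoColoredGraph.H₈
    · exact Or.inr (Or.inl (le_antisymm (TwoColoredGraph.turanDensity_le_four_thirds h2) (hT' h1)))
    · exact Or.inr (Or.inr (le_antisymm (TwoColoredGraph.turanDensity_le_three_halves hB)
        (h8' h2)))
  · by_contra hc
    have h1 := hT' hc
    rw [show H.turanDensity = 1 from h] at h1
    norm_num at h1
  · by_contra hc
    have h1 := h8' hc
    rw [h] at h1
    norm_num at h1
  · rw [hT hc] at h
    norm_num at h
  · have h1 := TwoColoredGraph.turanDensity_le_four_thirds hc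
    rw [h] at h1
    norm_num at h1
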